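/- Let $d\ge 2$ and let $w_1\ge w_2\ge\cdots\ge w_d>0$ be real numbers with $w_1+\cdots+w_d=1$. Put $\mathsf p_n:=w_1^n+\cdots+w_d^n$ for $n\ge 1$. Let $S_\infty$ be the group of permutations of $\{1,2,3,\dots\}$ which fix all but finitely many points, and define $\chi:S_\infty\to\mathbb R$ by $$\chi(\sigma):=\prod_{V\text{ orbit of }\sigma,\ |V|\ge 2}\mathsf p_{|V|}$$ (the empty product being $1$). Let $\mathcal H$ with $\sigma\mapsto\widehat\sigma$ be a GNS space of $\chi$, that is, $\mathcal H$ is a complex Hilbert space and $S_\infty\to\mathcal H$, $\sigma\mapsto\widehat\sigma$, is a map whose image spans a dense subspace and for which $\langle\widehat\sigma,\widehat\tau\rangle=\chi(\sigma\tau^{-1})$ for all $\sigma,\tau\in S_\infty$. For $\sigma\in S_\infty$ let $U(\sigma)$ be the bounded operator on $\mathcal H$ with $U(\sigma)\widehat\tau=\widehat{\sigma\tau}$ for all $\tau\in S_\infty$. Let $\mathcal M$ be the closure of $\mathrm{span}\{U(\sigma):\sigma\in S_\infty\}$ in the weak operator topology, and let $\mathrm{tr}(T):=\langle T\widehat e,\widehat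 e\rangle$, where $e$ is the unit of $S_\infty$. Finally, for $n\ge 1$ let $\gamma_n$ be the transposition $(1,n+1)$. Then the sequence $(U(\gamma_n))_{n\ge1}$ converges in the weak operator topology to a self-adjoint operator $A_0\in\mathcal M$, and the following hold. 1. $\mathrm{tr}(A_0^k)=\mathsf p_{k+1}$ for every integer $k\ge 0$. 2. The scalar spectral measure of $A_0$ with respect to $\mathrm{tr}$, i.e. the unique Borel probability measure $\mu$ on $\mathbb R$ which is concentrated on the spectrum of $A_0$ and satisfies $\mathrm{tr}(f(A_0))=\int f\,d\mu$ for all continuous $f:\mathbb R\to\mathbb R$, is $\sum_{i=1}^d w_i\,\delta_{w_i}$. 3. The spectrum of $A_0$ is $\{t\in(0,1)\mid \exists\,1\le i\le d \text{ such that } w_i=t\}$. In particular $A_0$ is invertible. Moreover, $A_0$ is a scalar multiple of the identity operator if and only if $w_1=\cdots=w_d=1/d$. -/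

import Mathlib

namespace StarTransposition

open scoped ComplexConjugate

/-- The group `S_∞` of finite permutations of `{1, 2, 3, …}`: all but finitely many points
are fixed. -/
def SInf : Subgroup (Equiv.Perm ℕ+) where
  carrier := {σ | ∃ n₀ : ℕ+, ∀ n, n₀ < n → σ n = n}
  one_mem' := ⟨1, fun _ _ => rfl⟩
  mul_mem' := by
    rintro σ τ ⟨a, ha⟩ ⟨b, hb⟩
    refine ⟨max a b, fun n hn => ?_⟩
    rw [Equiv.Perm.mul_apply, hb n ((le_max_right a b).trans_lt hn),
      ha n ((le_max_left a b).trans_lt hn)]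
  inv_mem' := by
    rintro σ ⟨a, ha⟩
    exact ⟨a, fun n hn => Equiv.Perm.inv_eq_iff_eq.mpr (ha n hn).symm⟩

/-- The star-transposition `γ_n = (1, n+1)`, for `n = 1, 2, 3, …`. -/
def gam (n : ℕ+) : SInf :=
  ⟨Equiv.swap 1 (n + 1), n + 1, fun _ hm =>
    Equiv.swap_apply_of_ne_of_ne (ne_of_gt (lt_of_le_of_lt one_le hm)) (ne_of_gt hm)⟩

/-- The power sum `p_n = w_1 ^ n + ⋯ + w_d ^ n`. -/
def powerSum {d : ℕ} (w : Fin d → ℝ) (n : ℕ) : ℝ := ∑ i, w i ^ n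

/-- The set of orbits of `σ` which have at least two elements. -/
def bigOrbits (σ : Equiv.Perm ℕ+) : Set (Set ℕ+) :=
  {V | (∃ n, V = {m | σ.SameCycle n m}) ∧ 2 ≤ V.ncard}

/-- The function `χ(σ) = ∏ p_{|V|}`, the product over the orbits `V` of `σ` with `|V| ≥ 2`
(a finite set of finite orbits; the empty product is `1`). -/
noncomputable def chi {d : ℕ} (w : Fin d → ℝ) (σ : SInf) : ℝ :=
  ∏ᶠ V ∈ bigOrbits σ, powerSum w V.ncard

/-- A GNS space for `χ`: a Hilbert space `H` with a map `σ ↦ σ̂` from `S_∞` to `H`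
whose image spans a dense subspace, and such that `⟨σ̂, τ̂⟩ = χ(σ τ⁻¹)`.  Here `⟨·,·⟩` is linear
in its first argument, so that `⟨x, y⟩` is `inner ℂ y x`. -/
structure GNS {d : ℕ} (w : Fin d → ℝ) (H : Type*) [NormedAddCommGroup H]
    [InnerProductSpace ℂ H] [CompleteSpace H] where
  /-- the map `σ ↦ σ̂` -/
  hat : SInf → H
  dense_span : Dense (Submodule.span ℂ (Set.range hat) : Set H)
  inner_hat : ∀ σ τ : SInf, inner ℂ (hat τ) (hat σ) = (chi w (σ * τ⁻¹) : ℂ)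

section Operators

variable {d : ℕ} {w : Fin d → ℝ} {H : Type*} [NormedAddCommGroup H]
  [InnerProductSpace ℂ H] [CompleteSpace H]

/-- The operator `U(σ)`, the continuous extension of the linear map with `τ̂ ↦ (στ)^`;
see `GNS.U_hat` below. -/
noncomputable def GNS.U (G : GNS w H) (σ : SInf) : H →L[ℂ] H :=
  (Finsupp.linearCombination ℂ fun τ => G.hat (σ * τ)).extendOfNorm
    (Finsupp.linearCombination ℂ G.hat)

/-- The von Neumann algebra `M`: the closure in the weak operator topology of the linear span
of the operators `U(σ)`. -/
def GNS.M (G : GNS w H) : Set (H →L[ℂ] H) :=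
  {T | ContinuousLinearMapWOT.ofCLM T ∈
    closure (Submodule.span ℂ (Set.range fun σ : SInf =>
      (ContinuousLinearMapWOT.ofCLM (G.U σ) : H →WOT[ℂ] H)) : Set (H →WOT[ℂ] H))}

/-- The functional `tr(T) = ⟨T ê, ê⟩`, with `e` the unit of `S_∞`.  It is a trace on `M`. -/
noncomputable def GNS.tr (G : GNS w H) (T : H →L[ℂ] H) : ℂ :=
  inner ℂ (G.hat 1) (T (G.hat 1))

/-- `μ` is the scalar spectral measure of the self-adjoint operator `A` with respect to the
functional `φ`: a Borel probability measure on `ℝ` which lives on the spectrum of `A` and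
satisfies `φ(f(A)) = ∫ f dμ` for all continuous `f`, where `f(A)` is given by the continuous
functional calculus. -/
def IsScalarSpectralMeasure (φ : (H →L[ℂ] H) → ℂ) (A : H →L[ℂ] H)
    (μ : MeasureTheory.Measure ℝ) : Prop :=
  IsSelfAdjoint A ∧ MeasureTheory.IsProbabilityMeasure μ ∧ μ (spectrum ℝ A)ᶜ = 0 ∧
    ∀ f : ℝ → ℝ, Continuous f → φ (cfc f A) = ((∫ t, f t ∂μ : ℝ) : ℂ)

end Operators

/-! ### `χ` is a class function, and the defining property of `U(σ)` -/

theorem chi_conj {d : ℕ} (w : Fin d → ℝ) (σ τ : SInf) : chi w (τ * σ * τ⁻¹) = chi w σ := by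
  unfold chi
  symm
  refine finprod_mem_eq_of_bijOn (fun V => (τ : Equiv.Perm ℕ+) '' V) ⟨?_, ?_, ?_⟩ ?_
  · rintro V ⟨⟨n, rfl⟩, h2⟩
    refine ⟨⟨(τ : Equiv.Perm ℕ+) n, ?_⟩, ?_⟩
    · ext m
      simp [Equiv.Perm.sameCycle_conj, Equiv.image_eq_preimage_symm]
    · rwa [Set.ncard_image_of_injective _ (Equiv.injective _)]
  · exact ((Set.image_injective.mpr (τ : Equiv.Perm ℕ+).injective)).injOn
  · rintro V ⟨⟨n, rfl⟩, h2⟩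
    have key : (τ : Equiv.Perm ℕ+) '' {m | (σ : Equiv.Perm ℕ+).SameCycle
        ((τ : Equiv.Perm ℕ+)⁻¹ n) m} = {m | ((τ * σ * τ⁻¹ : SInf) : Equiv.Perm ℕ+).SameCycle n m}
        := by
      ext m
      simp [Equiv.Perm.sameCycle_conj, Equiv.image_eq_preimage_symm]
    refine ⟨_, ⟨⟨(τ : Equiv.Perm ℕ+)⁻¹ n, rfl⟩, ?_⟩, key⟩
    rw [← key, Set.ncard_image_of_injective _ (Equiv.injective _)] at h2
    exact h2
  · intro V _
    simp only [Set.ncard_image_of_injective _ (Equiv.injective _)]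

theorem GNS.U_hat {d : ℕ} {w : Fin d → ℝ} {H : Type*} [NormedAddCommGroup H]
    [InnerProductSpace ℂ H] [CompleteSpace H] (G : GNS w H) (σ τ : SInf) :
    G.U σ (G.hat τ) = G.hat (σ * τ) := by
  have hd : DenseRange (Finsupp.linearCombination ℂ G.hat) := by
    have h := G.dense_span
    rw [← Finsupp.range_linearCombination] at h
    exact h
  have hn : ∀ x : SInf →₀ ℂ, ‖Finsupp.linearCombination ℂ (fun τ => G.hat (σ * τ)) x‖
      ≤ 1 * ‖Finsupp.linearCombination ℂ G.hat x‖ := by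
    intro x
    rw [one_mul]
    refine le_of_eq ?_
    rw [@norm_eq_sqrt_re_inner ℂ, @norm_eq_sqrt_re_inner ℂ]
    congr 2
    simp only [Finsupp.linearCombination_apply, Finsupp.sum_inner, Finsupp.inner_sum,
      inner_smul_left, inner_smul_right, G.inner_hat]
    refine Finsupp.sum_congr fun a _ => ?_
    congr 1
    refine Finsupp.sum_congr fun b _ => ?_
    rw [show σ * a * (σ * b)⁻¹ = σ * (a * b⁻¹) * σ⁻¹ by group, chi_conj]
  have := LinearMap.extendOfNorm_eq (f := Finsupp.linearCombination ℂ fun τ => G.hat (σ * τ))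
    hd ⟨1, hn⟩ (Finsupp.single τ 1)
  simpa [GNS.U] using this

/-! ### `χ` is of positive type, so that a GNS space exists -/

section Existence

open Classical in
/-- The probability that a coloring of the points of `α`, drawn independently with the
distribution `w`, is invariant under `π`. -/
noncomputable def invProb {d : ℕ} (w : Fin d → ℝ) {α : Type} [Fintype α] (π : Equiv.Perm α) : ℝ :=
  ∑ f : α → Fin d, if ∀ a, f (π a) = f a then ∏ a, w (f a) else 0

open Classical in
theorem invProb_eq {d : ℕ} (w : Fin d → ℝ) {α : Type} [Fintype α] (π : Equiv.Perm α) :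
    invProb w π = ∏ q : Quotient (Equiv.Perm.SameCycle.setoid π),
      powerSum w (Fintype.card {a // Quotient.mk (Equiv.Perm.SameCycle.setoid π) a = q}) := by
  unfold invProb powerSum
  rw [Finset.prod_univ_sum, Fintype.piFinset_univ, ← Finset.sum_filter]
  symm
  have hinv : ∀ f : α → Fin d, (∀ a, f (π a) = f a) → ∀ a b, π.SameCycle a b → f a = f b := by
    rintro f hf a b ⟨i, rfl⟩
    have : ∀ i : ℤ, f ((π ^ i) a) = f a := by
      intro i
      induction i with
      | zero => simp
      | succ i ih => rw [add_comm, zpow_add, zpow_one, Equiv.Perm.mul_apply, hf, ih]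
      | pred i ih =>
        rw [← ih, show (-(i : ℤ)) = 1 + (-(i : ℤ) - 1) by ring, zpow_add, zpow_one,
          Equiv.Perm.mul_apply, hf]
        congr 3
        ring
    exact (this i).symm
  refine Finset.sum_bij' (fun g _ => fun a => g (Quotient.mk _ a))
    (fun f hf => fun q => Quotient.lift f (hinv f (by simpa using hf)) q) ?_ ?_ ?_ ?_ ?_
  · intro g _
    simp only [Finset.mem_filter, Finset.mem_univ, true_and]
    intro a
    congr 1
    exact Quotient.sound (⟨-1, by simp⟩ : π.SameCycle (π a) a)
  · intro f _
    simp
  · intro g _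
    funext q
    induction q using Quotient.inductionOn
    rfl
  · intro f _
    rfl
  · intro g _
    rw [← Finset.prod_fiberwise (s := Finset.univ)
      (g := fun a => Quotient.mk (Equiv.Perm.SameCycle.setoid π) a)]
    refine Finset.prod_congr rfl fun q _ => ?_
    rw [Finset.prod_congr rfl (g := fun _ => w (g q)) ?_, Finset.prod_const, Fintype.card_subtype]
    intro a ha
    simp only [Finset.mem_filter] at ha
    exact congrArg (fun q => w (g q)) ha.2

theorem map_le_iff {N : ℕ+} {σ : Equiv.Perm ℕ+} (h : ∀ n, N < n → σ n = n) (n : ℕ+) :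
    σ n ≤ N ↔ n ≤ N := by
  by_cases hn : n ≤ N
  · simp only [hn, iff_true]
    by_contra! h'
    have := σ.injective (h _ h')
    rw [this] at h'
    exact absurd hn (not_le.mpr h')
  · rw [h n (not_le.mp hn)]

open Classical in
theorem chi_eq_invProb {d : ℕ} (w : Fin d → ℝ) (hsum : ∑ i, w i = 1) (σ : SInf) (N : ℕ+)
    (h : ∀ n, N < n → (σ : Equiv.Perm ℕ+) n = n) [Fintype {n : ℕ+ // n ≤ N}] :
    chi w σ = invProb w ((σ : Equiv.Perm ℕ+).subtypePerm (p := (· ≤ N)) (map_le_iff h)) := by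
  set s : Equiv.Perm ℕ+ := (σ : Equiv.Perm ℕ+) with hs
  set π := s.subtypePerm (p := (· ≤ N)) (map_le_iff h) with hπ
  rw [invProb_eq]
  let F : Quotient (Equiv.Perm.SameCycle.setoid π) → Set ℕ+ := fun q =>
    (Subtype.val) '' {a | Quotient.mk (Equiv.Perm.SameCycle.setoid π) a = q}
  have hF : ∀ q, (F q).ncard =
      Fintype.card {a // Quotient.mk (Equiv.Perm.SameCycle.setoid π) a = q} := by
    intro q
    rw [Set.ncard_image_of_injective _ Subtype.val_injective, ← Nat.card_eq_fintype_card]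
    rfl
  have hFmk : ∀ a : {n : ℕ+ // n ≤ N}, F (Quotient.mk _ a) = {m | s.SameCycle a m} := by
    intro a
    ext m
    simp only [F, Set.mem_image, Set.mem_ofPred_eq]
    constructor
    · rintro ⟨b, hb, rfl⟩
      have hb' : π.SameCycle b a := Quotient.exact hb
      exact ((Equiv.Perm.sameCycle_subtypePerm (h := map_le_iff h)).mp hb').symm
    · intro hm
      have hmN : m ≤ N := by
        obtain ⟨i, rfl⟩ := hm
        have := ((π ^ i) a).2
        rwa [hπ, Equiv.Perm.subtypePerm_zpow] at this
      refine ⟨⟨m, hmN⟩, ?_, rfl⟩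
      refine Quotient.sound (?_ : π.SameCycle _ _)
      exact (Equiv.Perm.sameCycle_subtypePerm (h := map_le_iff h)).mpr hm.symm
  rw [← finprod_eq_prod_of_fintype]
  have h1 : (∏ᶠ q : Quotient (Equiv.Perm.SameCycle.setoid π),
      powerSum w (Fintype.card {a // Quotient.mk (Equiv.Perm.SameCycle.setoid π) a = q})) =
      ∏ᶠ q ∈ {q | 2 ≤ (F q).ncard}, powerSum w (F q).ncard := by
    refine finprod_congr fun q => ?_
    rw [← hF]
    by_cases hq : 2 ≤ (F q).ncard
    · simp [hq]
    · have h0 : (F q).ncard ≠ 0 := by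
        rw [hF]
        obtain ⟨a, rfl⟩ := Quotient.exists_rep q
        exact (Fintype.card_pos_iff.mpr ⟨⟨a, rfl⟩⟩).ne'
      have h1 : (F q).ncard = 1 := by omega
      simp [h1, powerSum, hsum]
  rw [h1]
  symm
  refine finprod_mem_eq_of_bijOn F ⟨?_, ?_, ?_⟩ fun _ _ => rfl
  · intro q hq
    obtain ⟨a, rfl⟩ := Quotient.exists_rep q
    exact ⟨⟨a, hFmk a⟩, hq⟩
  · intro q _ r _ hqr
    obtain ⟨a, rfl⟩ := Quotient.exists_rep q
    obtain ⟨b, hb, hba⟩ : (a : ℕ+) ∈ F r := by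
      rw [← hqr]
      exact ⟨a, rfl, rfl⟩
    rw [Subtype.val_injective hba] at hb
    exact hb
  · rintro V ⟨⟨n, rfl⟩, h2⟩
    have hn : n ≤ N := by
      by_contra! hn
      have hfix : {m | s.SameCycle n m} = {n} := by
        ext m
        simp only [Set.mem_ofPred_eq, Set.mem_singleton_iff]
        constructor
        · rintro ⟨i, rfl⟩
          exact Equiv.Perm.zpow_apply_eq_self_of_apply_eq_self (h n hn) i
        · rintro rfl
          exact Equiv.Perm.SameCycle.refl _ _
      rw [hfix, Set.ncard_singleton] at h2
      omega
    refine ⟨Quotient.mk _ ⟨n, hn⟩, ?_, hFmk ⟨n, hn⟩⟩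
    change 2 ≤ (F _).ncard
    rw [hFmk]
    exact h2

open Classical in
theorem exists_bound (S : Finset SInf) :
    ∃ N : ℕ+, ∀ σ ∈ S, ∀ n, N < n → (σ : Equiv.Perm ℕ+) n = n := by
  induction S using Finset.induction with
  | empty => exact ⟨1, by simp⟩
  | insert σ S _ ih =>
    obtain ⟨N, hN⟩ := ih
    obtain ⟨M, hM⟩ := σ.2
    refine ⟨max N M, fun τ hτ n hn => ?_⟩
    rcases Finset.mem_insert.mp hτ with rfl | hτ
    · exact hM n ((le_max_right N M).trans_lt hn)
    · exact hN τ hτ n ((le_max_left N M).trans_lt hn)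

open Classical in
/-- `χ` is of positive type. -/
theorem chi_posType {d : ℕ} (w : Fin d → ℝ) (hpos : ∀ i, 0 < w i) (hsum : ∑ i, w i = 1)
    (c : SInf →₀ ℂ) :
    0 ≤ (c.sum fun σ a => c.sum fun τ b => conj b * a * (chi w (σ * τ⁻¹) : ℂ)).re := by
  obtain ⟨N, hN⟩ := exists_bound c.support
  let α := {n : ℕ+ // n ≤ N}
  let π : SInf → α → α := fun σ =>
    if h : ∀ n, N < n → (σ : Equiv.Perm ℕ+) n = n then
      (σ : Equiv.Perm ℕ+).subtypePerm (p := (· ≤ N)) (map_le_iff h) else id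
  have : Fintype α := (Set.finite_Iic N).fintype
  have key : ∀ σ ∈ c.support, ∀ τ ∈ c.support, chi w (σ * τ⁻¹) =
      ∑ f : α → Fin d, ∑ g : α → Fin d, (∏ a, w (f a)) *
        ((if f ∘ π σ = g then 1 else 0) * (if f ∘ π τ = g then 1 else 0)) := by
    intro σ hσ τ hτ
    have hs := hN σ hσ
    have ht := hN τ hτ
    have hst : ∀ n, N < n → ((σ * τ⁻¹ : SInf) : Equiv.Perm ℕ+) n = n := by
      intro n hn
      have : (τ : Equiv.Perm ℕ+)⁻¹ n = n := Equiv.Perm.inv_eq_iff_eq.mpr (ht n hn).symm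
      change (σ : Equiv.Perm ℕ+) ((τ : Equiv.Perm ℕ+)⁻¹ n) = n
      rw [this, hs n hn]
    rw [chi_eq_invProb w hsum _ N hst, invProb]
    refine Finset.sum_congr (by ext; simp) fun f _ => ?_
    rw [← Finset.mul_sum]
    have e1 : (∑ g : α → Fin d, ((if f ∘ π σ = g then (1 : ℝ) else 0) *
        (if f ∘ π τ = g then 1 else 0))) = if f ∘ π τ = f ∘ π σ then 1 else 0 := by
      simp [@eq_comm _ (f ∘ π τ)]
    rw [e1]
    have e2 : (∀ a, f (((σ * τ⁻¹ : SInf) : Equiv.Perm ℕ+).subtypePerm (p := (· ≤ N))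
        (map_le_iff hst) a) = f a) ↔ f ∘ π τ = f ∘ π σ := by
      constructor
      · intro h
        funext a
        have := h (π τ a)
        simp only [π, dif_pos hs, dif_pos ht, Function.comp] at this ⊢
        rw [← this]
        congr 1
        ext
        simp
      · intro h a
        have ht' : ∀ n, N < n → ((τ : Equiv.Perm ℕ+)⁻¹) n = n := fun n hn =>
          Equiv.Perm.inv_eq_iff_eq.mpr (ht n hn).symm
        have := congrFun h ((τ : Equiv.Perm ℕ+)⁻¹.subtypePerm (p := (· ≤ N)) (map_le_iff ht') a)
        simp only [π, dif_pos hs, dif_pos ht, Function.comp] at this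
        have hx : (τ : Equiv.Perm ℕ+).subtypePerm (p := (· ≤ N)) (map_le_iff ht)
            ((τ : Equiv.Perm ℕ+)⁻¹.subtypePerm (p := (· ≤ N)) (map_le_iff ht') a) = a :=
          Subtype.ext (Equiv.apply_symm_apply _ _)
        rw [hx] at this
        exact this.symm
    by_cases hc : f ∘ π τ = f ∘ π σ
    · rw [if_pos hc, if_pos (e2.mpr hc), mul_one]
    · rw [if_neg hc, if_neg (fun h => hc (e2.mp h)), mul_zero]
  have main : (c.sum fun σ a => c.sum fun τ b => conj b * a * (chi w (σ * τ⁻¹) : ℂ)) =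
      ((∑ f : α → Fin d, ∑ g : α → Fin d, (∏ a, w (f a)) *
        Complex.normSq (∑ σ ∈ c.support, if f ∘ π σ = g then c σ else 0) : ℝ) : ℂ) := by
    have step : (c.sum fun σ a => c.sum fun τ b => conj b * a * (chi w (σ * τ⁻¹) : ℂ)) =
        ∑ σ ∈ c.support, ∑ τ ∈ c.support, ∑ f : α → Fin d, ∑ g : α → Fin d,
          ((∏ a, w (f a) : ℝ) : ℂ) * ((if f ∘ π σ = g then c σ else 0) *
            conj (if f ∘ π τ = g then c τ else 0)) := by
      refine Finset.sum_congr rfl fun σ hσ => Finset.sum_congr rfl fun τ hτ => ?_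
      beta_reduce
      rw [key σ hσ τ hτ]
      push_cast
      simp only [Finset.mul_sum]
      refine Finset.sum_congr rfl fun f _ => Finset.sum_congr rfl fun g _ => ?_
      split_ifs <;> simp
      ring
    rw [step]
    push_cast
    simp only [← Complex.mul_conj, map_sum, Finset.sum_mul_sum]
    simp only [Finset.mul_sum]
    simp only [Finset.sum_comm (s := c.support) (t := Finset.univ)]
  rw [main, Complex.ofReal_re]
  exact Finset.sum_nonneg fun f _ => Finset.sum_nonneg fun g _ =>
    mul_nonneg (Finset.prod_nonneg fun a _ => (hpos _).le) (Complex.normSq_nonneg _)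

/-- A GNS space for `χ` exists. -/
theorem exists_GNS {d : ℕ} (w : Fin d → ℝ) (hpos : ∀ i, 0 < w i) (hsum : ∑ i, w i = 1) :
    ∃ (H : Type) (_ : NormedAddCommGroup H) (_ : InnerProductSpace ℂ H) (_ : CompleteSpace H),
      Nonempty (GNS w H) := by
  let K : Matrix SInf SInf (ℂ →L[ℂ] ℂ) :=
    Matrix.of fun σ τ => (chi w (σ * τ⁻¹) : ℂ) • ContinuousLinearMap.id ℂ ℂ
  have hinv : ∀ σ τ : SInf, chi w (σ * τ⁻¹) = chi w (τ * σ⁻¹) := by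
    intro σ τ
    rw [show τ * σ⁻¹ = (σ * τ⁻¹)⁻¹ by group]
    unfold chi bigOrbits
    rw [Subgroup.coe_inv]
    simp only [Equiv.Perm.sameCycle_inv]
  have hH : K.IsHermitian := by
    ext σ τ
    have h1 : star (ContinuousLinearMap.id ℂ ℂ) = ContinuousLinearMap.id ℂ ℂ :=
      star_one (ℂ →L[ℂ] ℂ)
    simp [K, Matrix.conjTranspose_apply, hinv σ τ, star_smul, h1]
  have hK : K.PosSemidef := by
    have ht : K.PosSemidef ↔ K.IsHermitian ∧ ∀ (vv : SInf →₀ ℂ),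
        0 ≤ RCLike.re (vv.sum fun x w ↦ vv.sum fun x' w' ↦ inner ℂ (K x' x w) w') :=
      (RKHS.posSemidef_tfae (K := K)).out 0 2
    refine ht.mpr ⟨hH, fun c => ?_⟩
    have := chi_posType w hpos hsum c
    rw [Finsupp.sum_comm] at this
    convert this using 1
    change (_ : ℂ).re = _
    congr 1
    refine Finsupp.sum_congr fun σ _ => Finsupp.sum_congr fun τ _ => ?_
    simp [K]
    ring
  have : Fact K.PosSemidef := ⟨hK⟩
  refine ⟨RKHS.OfKernel K, inferInstance, inferInstance, inferInstance,
    ⟨fun σ => RKHS.kerFun (RKHS.OfKernel K) σ 1, ?_, fun σ τ => ?_⟩⟩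
  · have h := RKHS.kerFun_dense (𝕜 := ℂ) (RKHS.OfKernel K)
    rw [← Submodule.dense_iff_topologicalClosure_eq_top] at h
    refine h.mono ?_
    rw [SetLike.coe_subset_coe, Submodule.span_le]
    rintro _ ⟨σ, v, rfl⟩
    have : RKHS.kerFun (RKHS.OfKernel K) σ v = v • RKHS.kerFun (RKHS.OfKernel K) σ 1 := by
      rw [← map_smul, smul_eq_mul, mul_one]
    rw [this]
    exact Submodule.smul_mem _ _ (Submodule.subset_span ⟨σ, rfl⟩)
  · rw [← RKHS.kernel_inner, RKHS.OfKernel.kernel_ofKernel]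
    simp [K]

end Existence

end StarTransposition

/-! Left multiplication by `gam n` with `n` large inserts a new point into the cycle through `1`. Up
to conjugation the result does not depend on `n`, so all matrix coefficients of `U (gam n)` between
vectors `hat σ` are eventually constant, and a weak limit `A` exists. Applying `A` to the vector of
an `m`-cycle through `1` acts under the trace like passing to an `(m+1)`-cycle, so the moments of
`A` are the power sums (`inner_pow_hat_cycle`). These moments are the same at every `hat σ`
(`inner_pow_hat`), so for real polynomials `‖p(A) (hat σ)‖² = ∑ w i * p (w i) ^ 2`. Since the `hat
σ` are total, `p(A) = 0` exactly when `p` vanishes at all weights (`aeval_eq_zero_iff`). The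
spectrum, the spectral measure, invertibility and the scalar case all follow from this algebraic
fact, without solving a moment problem. -/

namespace StarTransposition

open Filter Topology Polynomial

/-! ### Weak operator limits of contractions -/

section WeakLimits

variable {H : Type*} [NormedAddCommGroup H] [InnerProductSpace ℂ H]

/-- A sequence of functions with a common Lipschitz constant which converges on a dense set
converges everywhere. -/
theorem exists_tendsto_of_lipschitz_of_dense {X : Type*} [PseudoMetricSpace X] {K : NNReal}
    {φ : ℕ+ → X → ℂ} (hφ : ∀ n, LipschitzWith K (φ n)) {D : Set X} (hD : Dense D)
    (h : ∀ x ∈ D, ∃ c, Tendsto (fun n => φ n x) atTop (𝓝 c)) (x : X) :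
    ∃ c, Tendsto (fun n => φ n x) atTop (𝓝 c) := by
  refine cauchySeq_tendsto_of_complete (Metric.cauchySeq_iff'.mpr fun ε hε => ?_)
  have hK : (0 : ℝ) < K + 1 := by positivity
  -- Dividing by `K + 1` rather than `K` covers `K = 0`.
  obtain ⟨z, hz, hxz⟩ := hD.exists_dist_lt x (ε := ε / (3 * (K + 1))) (by positivity)
  obtain ⟨c, hc⟩ := h z hz
  obtain ⟨N, hN⟩ := Metric.cauchySeq_iff'.mp hc.cauchySeq (ε / 3) (by positivity)
  refine ⟨N, fun n hn => ?_⟩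
  have key : K * dist x z < ε / 3 := by
    have h1 : (K + 1) * dist x z < (K + 1) * (ε / (3 * (K + 1))) := by gcongr
    have h2 : (K + 1) * (ε / (3 * (K + 1))) = ε / 3 := by field_simp
    nlinarith [dist_nonneg (x := x) (y := z)]
  have h1 := (hφ n).dist_le_mul x z
  have h2 := (hφ N).dist_le_mul z x
  rw [dist_comm z x] at h2
  have h3 := hN n hn
  have h4 := dist_triangle4 (φ n x) (φ n z) (φ N z) (φ N x)
  linarith

/-- A sequence of contractions whose matrix coefficients converge on a total set converges in the
weak operator topology. -/
theorem exists_tendsto_wot [CompleteSpace H] {T : ℕ+ → H →L[ℂ] H} (hT : ∀ n, ‖T n‖ ≤ 1)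
    {S : Set H} (hS : Dense (Submodule.span ℂ S : Set H))
    (h : ∀ x ∈ S, ∀ y ∈ S, ∃ c, Tendsto (fun n => inner ℂ y (T n x)) atTop (𝓝 c)) :
    ∃ A : H →L[ℂ] H, Tendsto (fun n => (ContinuousLinearMapWOT.ofCLM (T n) : H →WOT[ℂ] H))
      atTop (𝓝 (ContinuousLinearMapWOT.ofCLM A)) := by
  have hT' : ∀ n x, ‖T n x‖ ≤ ‖x‖ := fun n x => by
    simpa using (T n).le_of_opNorm_le (hT n) x
  have h1 : ∀ x, ∀ y ∈ S, ∃ c, Tendsto (fun n => inner ℂ y (T n x)) atTop (𝓝 c) := by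
    intro x y hy
    refine exists_tendsto_of_lipschitz_of_dense (K := ‖y‖₊) (φ := fun n x => inner ℂ y (T n x))
      (fun n => LipschitzWith.of_dist_le_mul fun a b => ?_) hS (fun x hx => ?_) x
    · rw [dist_eq_norm, dist_eq_norm, ← inner_sub_right, ← map_sub]
      exact (norm_inner_le_norm _ _).trans (mul_le_mul_of_nonneg_left (hT' _ _) (norm_nonneg _))
    · induction hx using Submodule.span_induction with
      | mem x hx => exact h x hx y hy
      | zero => exact ⟨0, by simp⟩
      | add a b _ _ ha hb =>
        obtain ⟨c, hc⟩ := ha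
        obtain ⟨e, he⟩ := hb
        exact ⟨c + e, by simpa [inner_add_right] using hc.add he⟩
      | smul r a _ ha =>
        obtain ⟨c, hc⟩ := ha
        exact ⟨r * c, by simpa [inner_smul_right] using hc.const_mul r⟩
  -- The arguments are flipped so that the limit is conjugate-linear in `x` and linear in `y`, the
  -- kind of form that `continuousLinearMapOfBilin` represents by an operator.
  have h2 : ∀ x y, ∃ c, Tendsto (fun n => inner ℂ (T n x) y) atTop (𝓝 c) := by
    intro x y
    refine exists_tendsto_of_lipschitz_of_dense (K := ‖x‖₊) (φ := fun n y => inner ℂ (T n x) y)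
      (fun n => LipschitzWith.of_dist_le_mul fun a b => ?_) hS (fun y hy => ?_) y
    · rw [dist_eq_norm, dist_eq_norm, ← inner_sub_right]
      exact (norm_inner_le_norm _ _).trans (mul_le_mul_of_nonneg_right (hT' _ _) (norm_nonneg _))
    · induction hy using Submodule.span_induction with
      | mem y hy =>
        obtain ⟨c, hc⟩ := h1 x y hy
        exact ⟨star c, by simpa [inner_conj_symm] using hc.star⟩
      | zero => exact ⟨0, by simp⟩
      | add a b _ _ ha hb =>
        obtain ⟨c, hc⟩ := ha
        obtain ⟨e, he⟩ := hb
        exact ⟨c + e, by simpa [inner_add_right] using hc.add he⟩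
      | smul r a _ ha =>
        obtain ⟨c, hc⟩ := ha
        exact ⟨r * c, by simpa [inner_smul_right] using hc.const_mul r⟩
  choose c hc using h2
  let B : H →ₗ⋆[ℂ] H →ₗ[ℂ] ℂ := LinearMap.mk₂'ₛₗ (starRingEnd ℂ) (RingHom.id ℂ) c
    (fun x x' y => tendsto_nhds_unique (hc _ _)
      (by simpa [inner_add_left] using (hc x y).add (hc x' y)))
    (fun r x y => tendsto_nhds_unique (hc _ _)
      (by simpa [inner_smul_left, mul_comm] using (hc x y).const_mul (starRingEnd ℂ r)))
    (fun x y y' => tendsto_nhds_unique (hc _ _)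
      (by simpa [inner_add_right] using (hc x y).add (hc x y')))
    (fun r x y => tendsto_nhds_unique (hc _ _)
      (by simpa [inner_smul_right] using (hc x y).const_mul r))
  let B' : H →L⋆[ℂ] H →L[ℂ] ℂ := B.mkContinuous₂ 1 fun x y =>
    le_of_tendsto (hc x y).norm (Eventually.of_forall fun n => by
      rw [one_mul]
      exact (norm_inner_le_norm _ _).trans (mul_le_mul_of_nonneg_right (hT' _ _) (norm_nonneg _)))
  refine ⟨InnerProductSpace.continuousLinearMapOfBilin B',
    ContinuousLinearMapWOT.tendsto_iff_forall_inner_apply_tendsto.mpr fun x y => ?_⟩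
  have := (hc x y).star
  rw [show c x y = B' x y from rfl, ← InnerProductSpace.continuousLinearMapOfBilin_apply] at this
  simp only [← starRingEnd_apply, inner_conj_symm] at this
  exact this

end WeakLimits

/-! ### Cycles through `1` and the values of `chi` -/

section Cycles

/-- `σ` is a cycle of length `m` through the point `1`. -/
def IsCycleThroughOne (m : ℕ) (σ : SInf) : Prop :=
  ∃ l : List ℕ+, (1 :: l).Nodup ∧ l.length + 1 = m ∧ (σ : Equiv.Perm ℕ+) = (1 :: l).formPerm

/-- The degenerate cycle from which the moment computation starts. -/
theorem isCycleThroughOne_one : IsCycleThroughOne 1 1 := ⟨[], by simp⟩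

theorem IsCycleThroughOne.eventually_gam_mul {m : ℕ} {σ : SInf} (h : IsCycleThroughOne m σ) :
    ∀ᶠ n in atTop, IsCycleThroughOne (m + 1) (gam n * σ) := by
  obtain ⟨l, hl, rfl, hσ⟩ := h
  have : ∀ᶠ n : ℕ+ in atTop, ∀ a ∈ l.toFinset, a < n :=
    (Finset.eventually_all _).mpr fun a _ => eventually_gt_atTop a
  filter_upwards [this] with n hn
  have hnl : n + 1 ∉ l := fun hmem =>
    absurd (hn _ (List.mem_toFinset.mpr hmem)) (PNat.lt_add_right n 1).not_gt
  have h1 : n + 1 ≠ 1 := (PNat.lt_add_left 1 n).ne'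
  have hnd : ((n + 1) :: 1 :: l).Nodup := List.nodup_cons.mpr ⟨by simp [hnl, h1], hl⟩
  -- With `n + 1` in front, `formPerm_cons_cons` splits off the factor `swap (n + 1) 1`; rotating
  -- the list does not change the permutation.
  have hrot : ((n + 1) :: 1 :: l).rotate 1 = 1 :: (l ++ [n + 1]) := by simp
  refine ⟨l ++ [n + 1], ?_, by simp, ?_⟩
  · rw [← hrot]
    exact List.nodup_rotate.mpr hnd
  · rw [← hrot, List.formPerm_rotate _ hnd, List.formPerm_cons_cons, ← hσ, Equiv.swap_comm]
    rfl

variable {d : ℕ} (w : Fin d → ℝ)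

theorem IsCycleThroughOne.chi_eq (hsum : ∑ i, w i = 1) {m : ℕ} {σ : SInf}
    (h : IsCycleThroughOne m σ) : chi w σ = powerSum w m := by
  obtain ⟨l, hl, rfl, hσ⟩ := h
  unfold chi
  rcases l.eq_nil_or_concat with rfl | hne
  -- For `m = 1` the product is empty, and it matches because the first power sum is `1`.
  · have : bigOrbits (σ : Equiv.Perm ℕ+) = ∅ := by
      ext V
      simp only [bigOrbits, hσ, List.formPerm_singleton, Equiv.Perm.sameCycle_one,
        Set.mem_ofPred_eq, Set.mem_empty_iff_false, iff_false, not_and, not_le]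
      rintro ⟨n, rfl⟩
      simp
    simp [this, powerSum, hsum]
  · have hlen : 2 ≤ (1 :: l).length := by
      obtain ⟨_, _, rfl⟩ := hne
      simp
    have hcyc := List.isCycle_formPerm hl hlen
    have hmem : ∀ x, (1 :: l).formPerm x ≠ x ↔ x ∈ 1 :: l := fun x =>
      ⟨fun hx => by_contra fun hx' => hx (List.formPerm_apply_of_notMem hx'),
        fun hx => (List.formPerm_apply_mem_ne_self_iff _ hl _ hx).mpr hlen⟩
    have horb : ∀ x ∈ 1 :: l, {y | ((1 :: l).formPerm).SameCycle x y} =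
        ((1 :: l).toFinset : Set ℕ+) := by
      intro x hx
      ext y
      rw [Set.mem_ofPred_eq, (Equiv.Perm.isCycle_iff_sameCycle ((hmem x).mpr hx)).mp hcyc, hmem]
      simp
    have hcard : ((1 :: l).toFinset : Set ℕ+).ncard = l.length + 1 := by
      rw [Set.ncard_coe_finset, List.toFinset_card_of_nodup hl, List.length_cons]
    have : bigOrbits (σ : Equiv.Perm ℕ+) = {((1 :: l).toFinset : Set ℕ+)} := by
      ext V
      rw [Set.mem_singleton_iff, hσ]
      constructor
      · rintro ⟨⟨x, rfl⟩, h2⟩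
        by_cases hx : x ∈ 1 :: l
        · exact horb x hx
        · have hfix : {m | ((1 :: l).formPerm).SameCycle x m} = {x} := by
            ext m
            simp only [Set.mem_ofPred_eq, Set.mem_singleton_iff]
            constructor
            · rintro ⟨i, rfl⟩
              exact Equiv.Perm.zpow_apply_eq_self_of_apply_eq_self
                (List.formPerm_apply_of_notMem hx) i
            · rintro rfl
              exact Equiv.Perm.SameCycle.refl _ _
          rw [hfix, Set.ncard_singleton] at h2
          omega
      · rintro rfl
        exact ⟨⟨1, (horb 1 (by simp)).symm⟩, by rw [hcard]; exact hlen⟩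
    rw [this, finprod_mem_singleton, hcard]

/-- `χ(γ_n π)` does not depend on `n` for large `n`. -/
theorem exists_eventually_chi_gam_mul_eq (π : SInf) :
    ∃ c, ∀ᶠ n in atTop, chi w (gam n * π) = c := by
  obtain ⟨N, hN⟩ := π.2
  refine ⟨chi w (gam N * π), (eventually_ge_atTop N).mono fun n hn => ?_⟩
  have hN1 : N < N + 1 := PNat.lt_add_right N 1
  have hn1 : N < n + 1 := hn.trans_lt (PNat.lt_add_right n 1)
  -- Both `N + 1` and `n + 1` are fixed by `π`, so `s` commutes with `π`, while conjugation by `s`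
  -- turns `gam N` into `gam n`; `chi` is a class function.
  let s : SInf := ⟨Equiv.swap (N + 1) (n + 1), n + 1, fun m hm =>
    Equiv.swap_apply_of_ne_of_ne
      (ne_of_gt (lt_of_le_of_lt (add_le_add_left hn 1) hm)) (ne_of_gt hm)⟩
  have hinv : s⁻¹ = s := Subtype.ext (Equiv.swap_inv _ _)
  have hs1 : s * gam N * s⁻¹ = gam n := by
    refine Subtype.ext ?_
    change Equiv.swap (N + 1) (n + 1) * Equiv.swap 1 (N + 1) * (Equiv.swap (N + 1) (n + 1))⁻¹ = _
    rw [← Equiv.swap_apply_apply, Equiv.swap_apply_left, Equiv.swap_apply_of_ne_of_ne]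
    · rfl
    · exact (PNat.lt_add_left 1 N).ne
    · exact (PNat.lt_add_left 1 n).ne
  have hs2 : s * π * s⁻¹ = π := by
    refine Subtype.ext ?_
    change Equiv.swap (N + 1) (n + 1) * (π : Equiv.Perm ℕ+) * (Equiv.swap (N + 1) (n + 1))⁻¹ = _
    rw [mul_inv_eq_iff_eq_mul]
    conv_lhs => rw [← hN _ hN1, ← hN _ hn1]
    exact (Equiv.mul_swap_eq_swap_mul _ _ _).symm
  rw [← chi_conj w (gam N * π) s, ← hs1]
  congr 1
  nth_rewrite 1 [← hs2]
  group

theorem gam_mul_gam (n : ℕ+) : gam n * gam n = 1 := Subtype.ext (Equiv.swap_mul_self _ _)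

end Cycles

/-! ### The limit operator and its moments -/

section LimitOperator

variable {d : ℕ} {w : Fin d → ℝ} {H : Type*} [NormedAddCommGroup H]
  [InnerProductSpace ℂ H] [CompleteSpace H] (G : GNS w H)

theorem GNS.op_ext {A B : H →L[ℂ] H} (h : ∀ σ, A (G.hat σ) = B (G.hat σ)) : A = B :=
  ContinuousLinearMap.ext_on G.dense_span fun _ ⟨σ, hσ⟩ => hσ ▸ h σ

theorem GNS.vector_ext {x y : H} (h : ∀ σ, inner ℂ (G.hat σ) x = inner ℂ (G.hat σ) y) :
    x = y := by
  have : innerSL ℂ x = innerSL ℂ y := ContinuousLinearMap.ext_on G.dense_span (by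
    rintro _ ⟨σ, rfl⟩
    rw [innerSL_apply_apply, innerSL_apply_apply, ← inner_conj_symm, h σ, inner_conj_symm])
  exact ext_inner_right ℂ fun v => by simpa using DFunLike.congr_fun this v

/-- Left translation preserves the inner products of the `hat τ` because `chi` is a class function.
-/
theorem GNS.star_U (σ : SInf) : star (G.U σ) = G.U σ⁻¹ := by
  refine G.op_ext fun τ => G.vector_ext fun ρ => ?_
  rw [ContinuousLinearMap.star_eq_adjoint, ContinuousLinearMap.adjoint_inner_right, G.U_hat,
    G.U_hat, G.inner_hat, G.inner_hat, ← chi_conj w (τ * (σ * ρ)⁻¹) σ⁻¹]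
  congr 2
  group

theorem GNS.norm_U_le (σ : SInf) : ‖G.U σ‖ ≤ 1 := by
  have h : star (G.U σ) * G.U σ = 1 := by
    rw [G.star_U]
    refine G.op_ext fun τ => ?_
    rw [mul_apply_eq_comp, G.U_hat, G.U_hat, inv_mul_cancel_left]
    rfl
  have h2 := CStarRing.norm_star_mul_self (x := G.U σ)
  rw [h] at h2
  have h3 : ‖(1 : H →L[ℂ] H)‖ ≤ 1 := ContinuousLinearMap.norm_id_le
  nlinarith [norm_nonneg (G.U σ)]

/-- `A` is the limit of the operators `U(γ_n)` in the weak operator topology. -/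
def GNS.IsStarLimit (A : H →L[ℂ] H) : Prop :=
  Tendsto (fun n : ℕ+ => (ContinuousLinearMapWOT.ofCLM (G.U (gam n)) : H →WOT[ℂ] H))
    atTop (𝓝 (ContinuousLinearMapWOT.ofCLM A))

theorem GNS.exists_isStarLimit : ∃ A, G.IsStarLimit A := by
  refine exists_tendsto_wot (fun n => G.norm_U_le (gam n)) G.dense_span ?_
  rintro _ ⟨σ, rfl⟩ _ ⟨τ, rfl⟩
  obtain ⟨c, hc⟩ := exists_eventually_chi_gam_mul_eq w (σ * τ⁻¹)
  refine ⟨c, tendsto_const_nhds.congr' (hc.mono fun n hn => ?_)⟩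
  beta_reduce
  rw [G.U_hat, G.inner_hat, mul_assoc, hn]

variable {G} {A : H →L[ℂ] H} (hA : G.IsStarLimit A)
include hA

theorem GNS.IsStarLimit.tendsto_inner (x y : H) :
    Tendsto (fun n => inner ℂ y (G.U (gam n) x)) atTop (𝓝 (inner ℂ y (A x))) :=
  ContinuousLinearMapWOT.tendsto_iff_forall_inner_apply_tendsto.mp hA x y

theorem GNS.IsStarLimit.mem_M : A ∈ G.M :=
  mem_closure_of_tendsto hA
    (Eventually.of_forall fun n => Submodule.subset_span ⟨gam n, rfl⟩)

theorem GNS.IsStarLimit.isSelfAdjoint : IsSelfAdjoint A := by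
  refine ContinuousLinearMap.isSelfAdjoint_iff_isSymmetric.mpr fun x y => ?_
  refine tendsto_nhds_unique ?_ (hA.tendsto_inner y x)
  -- Taking adjoints is compatible with weak limits, and each `U (gam n)` is self-adjoint since `gam
  -- n` is an involution.
  have h := (hA.tendsto_inner x y).star
  simp only [← starRingEnd_apply, inner_conj_symm] at h
  refine h.congr fun n => ?_
  rw [← ContinuousLinearMap.adjoint_inner_right, ← ContinuousLinearMap.star_eq_adjoint,
    G.star_U, inv_eq_of_mul_eq_one_left (gam_mul_gam n)]

/-- Multiplication is not jointly continuous in the weak operator topology, so only the rightmost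
factor of `A ^ (k + 1)` is replaced by `U (gam n)`; self-adjointness moves the other factors onto
`y`. -/
theorem GNS.IsStarLimit.tendsto_inner_pow_succ (k : ℕ) (σ : SInf) (y : H) :
    Tendsto (fun n => inner ℂ y ((A ^ k) (G.hat (gam n * σ)))) atTop
      (𝓝 (inner ℂ y ((A ^ (k + 1)) (G.hat σ)))) := by
  have hs := hA.isSelfAdjoint.pow k
  have hk : ∀ x, inner ℂ y ((A ^ k) x) = inner ℂ ((A ^ k) y) x := fun x =>
    (ContinuousLinearMap.isSelfAdjoint_iff_isSymmetric.mp hs y x).symm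
  rw [pow_succ, mul_apply_eq_comp, hk]
  refine (hA.tendsto_inner (G.hat σ) ((A ^ k) y)).congr fun n => ?_
  rw [hk, G.U_hat]

/-- Left multiplication by `gam n` commutes with right multiplication by `τ⁻¹`. For `σ = τ` this
says that every `hat σ` sees the same moments as `hat 1`. -/
theorem GNS.IsStarLimit.inner_pow_hat (k : ℕ) (σ τ : SInf) :
    inner ℂ (G.hat τ) ((A ^ k) (G.hat σ)) =
      inner ℂ (G.hat 1) ((A ^ k) (G.hat (σ * τ⁻¹))) := by
  induction k generalizing σ with
  | zero =>
    change inner ℂ (G.hat τ) (G.hat σ) = inner ℂ (G.hat 1) (G.hat (σ * τ⁻¹))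
    rw [G.inner_hat, G.inner_hat, inv_one, mul_one]
  | succ k ih =>
    refine tendsto_nhds_unique (hA.tendsto_inner_pow_succ k σ (G.hat τ)) ?_
    refine (hA.tendsto_inner_pow_succ k (σ * τ⁻¹) (G.hat 1)).congr fun n => ?_
    rw [ih, mul_assoc]

/-- Each factor `A` is traded for a `gam n` with `n` large, which lengthens the cycle by one. The
length `m` must vary in the induction. -/
theorem GNS.IsStarLimit.inner_pow_hat_cycle (hsum : ∑ i, w i = 1) (k : ℕ) {m : ℕ} {σ : SInf}
    (hσ : IsCycleThroughOne m σ) :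
    inner ℂ (G.hat 1) ((A ^ k) (G.hat σ)) = (powerSum w (k + m) : ℂ) := by
  induction k generalizing m σ with
  | zero =>
    change inner ℂ (G.hat 1) (G.hat σ) = _
    rw [G.inner_hat, inv_one, mul_one, hσ.chi_eq w hsum, zero_add]
  | succ k ih =>
    refine tendsto_nhds_unique (hA.tendsto_inner_pow_succ k σ (G.hat 1)) ?_
    refine tendsto_const_nhds.congr' (hσ.eventually_gam_mul.mono fun n hn => ?_)
    beta_reduce
    rw [ih hn, add_right_comm, add_assoc]

/-! ### Polynomials in the limit operator, spectrum and spectral measure -/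

theorem GNS.IsStarLimit.tr_pow (hsum : ∑ i, w i = 1) (k : ℕ) :
    G.tr (A ^ k) = (powerSum w (k + 1) : ℂ) :=
  hA.inner_pow_hat_cycle hsum k isCycleThroughOne_one

/-- Stated at every `hat σ`, not only at `hat 1`, so that the vanishing of an operator can be tested
on a total set. -/
theorem GNS.IsStarLimit.inner_aeval_hat (hsum : ∑ i, w i = 1) (p : ℝ[X]) (σ : SInf) :
    inner ℂ (G.hat σ) (aeval A p (G.hat σ)) = ((∑ i, w i * p.eval (w i) : ℝ) : ℂ) := by
  induction p using Polynomial.induction_on' with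
  | add p q hp hq =>
    rw [map_add, add_apply, inner_add_right, hp, hq, ← Complex.ofReal_add,
      ← Finset.sum_add_distrib]
    simp only [eval_add, mul_add]
  | monomial k a =>
    have h := hA.tr_pow hsum k
    rw [GNS.tr] at h
    rw [aeval_monomial, ← Algebra.smul_def, smul_apply,
      ← Complex.coe_smul, inner_smul_right, hA.inner_pow_hat, mul_inv_cancel, h,
      ← Complex.ofReal_mul, powerSum, Finset.mul_sum]
    congr 1
    refine Finset.sum_congr rfl fun i _ => ?_
    rw [eval_monomial]
    ring

theorem GNS.IsStarLimit.tr_aeval (hsum : ∑ i, w i = 1) (p : ℝ[X]) :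
    G.tr (aeval A p) = ((∑ i, w i * p.eval (w i) : ℝ) : ℂ) :=
  hA.inner_aeval_hat hsum p 1

theorem GNS.IsStarLimit.isSelfAdjoint_aeval (p : ℝ[X]) : IsSelfAdjoint (aeval A p) := by
  rw [← cfc_polynomial p A hA.isSelfAdjoint]
  exact cfc_predicate _ _

/-- A real polynomial annihilates the limit operator if and only if it vanishes at the
weights. -/
theorem GNS.IsStarLimit.aeval_eq_zero_iff (hpos : ∀ i, 0 < w i) (hsum : ∑ i, w i = 1)
    (p : ℝ[X]) : aeval A p = 0 ↔ ∀ i, p.eval (w i) = 0 := by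
  constructor
  · intro h
    -- The trace of `p(A) ^ 2` is a sum of squares with positive weights.
    have h2 := hA.tr_aeval hsum (p * p)
    rw [map_mul, h, mul_zero, GNS.tr, zero_apply, inner_zero_right] at h2
    have h3 : ∑ i, w i * (p * p).eval (w i) = 0 := by exact_mod_cast h2.symm
    rw [Finset.sum_eq_zero_iff_of_nonneg fun i _ => by
      rw [eval_mul]
      exact mul_nonneg (hpos i).le (mul_self_nonneg _)] at h3
    intro i
    simpa [(hpos i).ne'] using h3 i (Finset.mem_univ i)
  · intro h
    refine G.op_ext fun σ => ?_
    -- By self-adjointness of `p(A)` this computes `‖p(A) (hat σ)‖²`, here zero.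
    have h2 := hA.inner_aeval_hat hsum (p * p) σ
    have h3 := ContinuousLinearMap.isSelfAdjoint_iff_isSymmetric.mp (hA.isSelfAdjoint_aeval p)
      (G.hat σ) (aeval A p (G.hat σ))
    rw [map_mul, mul_apply_eq_comp] at h2
    rw [zero_apply, ← inner_self_eq_zero (𝕜 := ℂ)]
    refine h3.trans (h2.trans ?_)
    simp [h]

theorem GNS.IsStarLimit.spectrum_real (hpos : ∀ i, 0 < w i) (hsum : ∑ i, w i = 1) :
    spectrum ℝ A = Set.range w := by
  classical
  ext t
  constructor
  · intro ht
    -- Spectral mapping: a polynomial that annihilates `A` vanishes on the spectrum.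
    have h0 : aeval A (∏ i, (X - C (w i))) = 0 :=
      (hA.aeval_eq_zero_iff hpos hsum _).mpr fun i => by
        rw [eval_prod]
        exact Finset.prod_eq_zero (Finset.mem_univ i) (by simp)
    have hmem := spectrum.subset_polynomial_aeval A (∏ i, (X - C (w i))) ⟨t, ht, rfl⟩
    have : Nontrivial (H →L[ℂ] H) := by
      by_contra hn
      rw [not_nontrivial_iff_subsingleton] at hn
      rw [spectrum.of_subsingleton] at ht
      exact ht
    rw [h0, spectrum.zero_eq, Set.mem_singleton_iff] at hmem
    beta_reduce at hmem
    rw [eval_prod, Finset.prod_eq_zero_iff] at hmem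
    obtain ⟨i, -, hi⟩ := hmem
    exact ⟨i, by simpa [sub_eq_zero, eq_comm] using hi⟩
  · rintro ⟨i, rfl⟩
    by_contra hi
    rw [spectrum.notMem_iff] at hi
    -- `q` vanishes at every weight value except `w i`; passing to the image discards repetitions.
    -- If `w i - A` were invertible, `(w i - A) q(A) = 0` would force `q(A) = 0`, hence `q (w i) =
    -- 0`.
    set q : ℝ[X] := ∏ t ∈ (Finset.univ.image w).erase (w i), (X - C t) with hq
    have h1 : aeval A ((C (w i) - X) * q) = 0 :=
      (hA.aeval_eq_zero_iff hpos hsum _).mpr fun j => by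
        rw [eval_mul, hq, eval_prod]
        by_cases hj : w j = w i
        · simp [hj]
        · rw [Finset.prod_eq_zero (i := w j) (by simp [hj]) (by simp), mul_zero]
    rw [map_mul, map_sub, aeval_C, aeval_X] at h1
    have h2 := (hA.aeval_eq_zero_iff hpos hsum q).mp (hi.mul_right_eq_zero.mp h1) i
    rw [hq, eval_prod, Finset.prod_eq_zero_iff] at h2
    obtain ⟨t, ht, ht0⟩ := h2
    simp only [eval_sub, eval_X, eval_C, sub_eq_zero] at ht0
    exact Finset.ne_of_mem_erase ht ht0.symm

theorem GNS.IsStarLimit.spectrum_complex (hpos : ∀ i, 0 < w i) (hsum : ∑ i, w i = 1) :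
    spectrum ℂ A = Complex.ofReal '' Set.range w := by
  rw [← hA.spectrum_real hpos hsum]
  exact hA.isSelfAdjoint.spectrumRestricts.algebraMap_image.symm

/-- On the finite spectrum `f` agrees with its Lagrange interpolant, so no continuity of `f` is
needed. The nodes are the distinct weight values. -/
theorem GNS.IsStarLimit.tr_cfc (hpos : ∀ i, 0 < w i) (hsum : ∑ i, w i = 1) (f : ℝ → ℝ) :
    G.tr (cfc f A) = ((∑ i, w i * f (w i) : ℝ) : ℂ) := by
  classical
  have hq : ∀ i, (Lagrange.interpolate (Finset.univ.image w) id f).eval (w i) = f (w i) :=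
    fun i => Lagrange.eval_interpolate_at_node (s := Finset.univ.image w) (v := id) f
      (Set.injOn_id _) (Finset.mem_image_of_mem w (Finset.mem_univ i))
  have h : Set.EqOn f (Lagrange.interpolate (Finset.univ.image w) id f).eval (spectrum ℝ A) := by
    rw [hA.spectrum_real hpos hsum]
    rintro _ ⟨i, rfl⟩
    exact (hq i).symm
  rw [cfc_congr h, cfc_polynomial _ A hA.isSelfAdjoint, hA.tr_aeval hsum]
  simp only [hq]

theorem GNS.IsStarLimit.isScalarSpectralMeasure_iff (hpos : ∀ i, 0 < w i)
    (hsum : ∑ i, w i = 1) (μ : MeasureTheory.Measure ℝ) :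
    IsScalarSpectralMeasure G.tr A μ ↔
      μ = ∑ i, ENNReal.ofReal (w i) • MeasureTheory.Measure.dirac (w i) := by
  set ν : MeasureTheory.Measure ℝ :=
    ∑ i, ENNReal.ofReal (w i) • MeasureTheory.Measure.dirac (w i) with hν
  have hprob : MeasureTheory.IsProbabilityMeasure ν := ⟨by
    simp only [hν, MeasureTheory.Measure.coe_finsetSum, Finset.sum_apply,
      MeasureTheory.Measure.smul_apply, MeasureTheory.measure_univ, smul_eq_mul, mul_one]
    rw [← ENNReal.ofReal_sum_of_nonneg fun i _ => (hpos i).le, hsum, ENNReal.ofReal_one]⟩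
  have hint : ∀ f : ℝ → ℝ, ∫ t, f t ∂ν = ∑ i, w i * f (w i) := by
    intro f
    rw [hν, MeasureTheory.integral_finsetSum_measure fun i _ =>
      (MeasureTheory.integrable_dirac (by simp)).smul_measure ENNReal.ofReal_ne_top]
    refine Finset.sum_congr rfl fun i _ => ?_
    rw [MeasureTheory.integral_smul_measure, MeasureTheory.integral_dirac,
      ENNReal.toReal_ofReal (hpos i).le, smul_eq_mul]
  constructor
  · rintro ⟨-, hμ, -, h⟩
    -- Finite measures are determined by their integrals of bounded continuous functions.
    refine MeasureTheory.ext_of_forall_integral_eq_of_IsFiniteMeasure fun f => ?_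
    have := h f f.continuous
    rw [hA.tr_cfc hpos hsum] at this
    rw [hint]
    exact_mod_cast this.symm
  · rintro rfl
    refine ⟨hA.isSelfAdjoint, hprob, ?_, fun f _ => by rw [hA.tr_cfc hpos hsum, hint]⟩
    rw [hA.spectrum_real hpos hsum]
    simp [hν]

theorem GNS.IsStarLimit.isUnit (hpos : ∀ i, 0 < w i) (hsum : ∑ i, w i = 1) : IsUnit A := by
  refine (spectrum.zero_notMem_iff ℝ).mp ?_
  rw [hA.spectrum_real hpos hsum]
  rintro ⟨i, hi⟩
  exact (hpos i).ne' hi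

theorem GNS.IsStarLimit.exists_eq_smul_one_iff (hpos : ∀ i, 0 < w i) (hsum : ∑ i, w i = 1) :
    (∃ c : ℂ, A = c • (1 : H →L[ℂ] H)) ↔ ∀ i, w i = 1 / (d : ℝ) := by
  constructor
  · rintro ⟨c, hc⟩ i
    have : Nontrivial (H →L[ℂ] H) := by
      by_contra hn
      rw [not_nontrivial_iff_subsingleton] at hn
      have h := hA.spectrum_real hpos hsum
      rw [spectrum.of_subsingleton] at h
      exact (h ▸ Set.mem_range_self i : w i ∈ (∅ : Set ℝ))
    -- A scalar operator has one-point spectrum, and every weight lies in the spectrum.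
    have hw : ∀ j, (w j : ℂ) = c := by
      intro j
      have hj : (w j : ℂ) ∈ spectrum ℂ A := by
        rw [hA.spectrum_complex hpos hsum]
        exact ⟨_, ⟨j, rfl⟩, rfl⟩
      rwa [hc, ← Algebra.algebraMap_eq_smul_one, spectrum.scalar_eq,
        Set.mem_singleton_iff] at hj
    have hw' : ∀ j, w j = w i := fun j => by exact_mod_cast (hw j).trans (hw i).symm
    have hd : (d : ℝ) * w i = 1 := by
      rw [← hsum, Finset.sum_congr rfl fun j _ => hw' j]
      simp
    exact eq_one_div_of_mul_eq_one_right hd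
  · intro h
    -- If all weights equal `1 / d`, a linear polynomial already annihilates `A`.
    have h1 := (hA.aeval_eq_zero_iff hpos hsum (X - C (1 / (d : ℝ)))).mpr fun i => by simp [h i]
    rw [map_sub, aeval_X, aeval_C, sub_eq_zero] at h1
    refine ⟨((1 / (d : ℝ) : ℝ) : ℂ), ?_⟩
    rw [h1, Algebra.algebraMap_eq_smul_one, Complex.coe_smul]

end LimitOperator

end StarTransposition

/-! ### The main theorem -/

theorem corollary3p6 {d : ℕ} (hd : 2 ≤ d) (w : Fin d → ℝ) (hmono : Antitone w)
    (hpos : ∀ i, 0 < w i) (hsum : ∑ i, w i = 1)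
    {H : Type*} [NormedAddCommGroup H] [InnerProductSpace ℂ H] [CompleteSpace H]
    (G : StarTransposition.GNS w H) :
    ∃ A₀ : H →L[ℂ] H,
      -- `A₀` is the limit of the operators `U(γ_n)` in the weak operator topology
      Filter.Tendsto (fun n : ℕ+ =>
        (ContinuousLinearMapWOT.ofCLM (G.U (StarTransposition.gam n)) : H →WOT[ℂ] H))
        Filter.atTop (nhds (ContinuousLinearMapWOT.ofCLM A₀)) ∧
      A₀ ∈ G.M ∧ IsSelfAdjoint A₀ ∧
      (∀ k : ℕ, G.tr (A₀ ^ k) = (StarTransposition.powerSum w (k + 1) : ℂ)) ∧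
      (∀ μ : MeasureTheory.Measure ℝ,
        StarTransposition.IsScalarSpectralMeasure G.tr A₀ μ ↔
          μ = ∑ i, ENNReal.ofReal (w i) • MeasureTheory.Measure.dirac (w i)) ∧
      spectrum ℂ A₀ = Complex.ofReal '' {t : ℝ | t ∈ Set.Ioo (0 : ℝ) 1 ∧ ∃ i, w i = t} ∧
      IsUnit A₀ ∧
      ((∃ c : ℂ, A₀ = c • (1 : H →L[ℂ] H)) ↔ ∀ i, w i = 1 / (d : ℝ)) := by
  obtain ⟨A, hA⟩ := G.exists_isStarLimit
  refine ⟨A, hA, hA.mem_M, hA.isSelfAdjoint, hA.tr_pow hsum,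
    hA.isScalarSpectralMeasure_iff hpos hsum, ?_, hA.isUnit hpos hsum,
    hA.exists_eq_smul_one_iff hpos hsum⟩
  rw [hA.spectrum_complex hpos hsum]
  congr 1
  ext t
  refine ⟨?_, fun h => h.2⟩
  rintro ⟨i, rfl⟩
  refine ⟨⟨hpos i, ?_⟩, i, rfl⟩
  -- A second index carries positive weight, so `w i` is strictly below the total `1`.
  have : Nontrivial (Fin d) := Fin.nontrivial_iff_two_le.mpr hd
  obtain ⟨j, hj⟩ := exists_ne i
  rw [← hsum]
  exact Finset.single_lt_sum hj (Finset.mem_univ i) (Finset.mem_univ j) (hpos j)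
    fun k _ _ => (hpos k).le
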